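/- Let $T\ge 1$, $0<\varepsilon<1$, $\zeta>0$, $\alpha\in(0,1)$, and let $\nu$ be a finite measure on $[\varepsilon,1]$ with $\nu([\varepsilon,1))>0$. For $b\in\mathbb{R}^T$ put $b_{RMS}=\big(\frac1T\sum_{l=1}^T b_l^2\big)^{1/2}$. Let $\beta\in\mathbb{R}^T$ and, for each sample size $n$ and each $\lambda\in[\varepsilon,1]$, let $\hat\beta(\lambda)=\hat\beta_n(\lambda)\in\mathbb{R}^T$ be an estimator of $\beta$ (based on a subsample of $\lfloor n\lambda\rfloor$ of the $n$ individuals), jointly measurable in $\lambda$ and the data. Assume sequential asymptotic normality: \[ \{\sqrt n(\hat\beta(\lambda)-\beta)\}_{\lambda\in[\varepsilon,1]}\rightsquigarrow\{\lambda^{-1}D\,\vec{\mathbb B}(\lambda)\}_{\lambda\in[\varepsilon,1]}\qquad(n\to\infty) \] weakly (in the sense of Hoffmann-J{\o}rgensen, that is, $\mathbb E^*f(X_n)\to\mathbb E f(X)$ for all bounded continuous $f$, with $\mathbb E^*$ the outer expectation) in the space $(\ell^\infty[\varepsilon,1])^T$ of $T$-tuples of bounded functions on $[\varepsilon,1]$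 with the uniform topology, where $\vec{\mathbb B}$ is a vector of $T$ independent Brownian motions and $D$ is a $T\times T$ matrix of full rank. Put $\hat\beta_{RMS}^2(\lambda)=(\hat\beta(\lambda))_{RMS}^2$, $\hat\beta_{RMS}^2=\hat\beta_{RMS}^2(1)$, \[ \hat V_n=\Big(\int_\varepsilon^1\big(\hat\beta_{RMS}^2(\lambda)-\hat\beta_{RMS}^2(1)\big)^2\,\nu(d\lambda)\Big)^{1/2},\qquad \mathbb W=\frac{\mathbb B(1)}{\big(\int_\varepsilon^1(\mathbb B(\lambda)/\lambda-\mathbb B(1))^2\,\nu(d\lambda)\big)^{1/2}}, \] where the integrals are over $[\varepsilon,1]$ and $\mathbb B$ is a one-dimensional Brownian motion, and let $\mathcal Q_{\mathbb W}(\alpha)$ be the $\alpha$-quantile of $\mathbb W$. Then the test that rejects $\mathrm H_0:\beta_{RMS}^2\ge\zeta^2$ in favour of $\mathrm H_1:\beta_{RMS}^2<\zeta^2$ whenever $\hat\beta_{RMS}^2<\zeta^2+\mathcal Q_{\mathbb W}(\alpha)\hat V_n$ satisfies \[ \lim_{n\to\infty}\mathbb P_\beta\big(\hat\beta_{RMS}^2<\zeta^2+\mathcal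 Q_{\mathbb W}(\alpha)\hat V_n\big)= \begin{cases}0,&\beta_{RMS}^2>\zeta^2,\\ \alpha,&\beta_{RMS}^2=\zeta^2,\\ 1,&\beta_{RMS}^2<\zeta^2.\end{cases} \] In particular it is a consistent asymptotic level-$\alpha$ test: its limiting rejection probability is at most $\alpha$ for every $\beta$ in $\mathrm H_0$ and equals $1$ for every $\beta$ in $\mathrm H_1$. -/

import Mathlib

open MeasureTheory ProbabilityTheory Filter Topology Set
open scoped NNReal ENNReal BoundedContinuousFunction

noncomputable section

/-- Root mean square of a vector `b ∈ ℝ^T`. -/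
def rms {T : ℕ} (b : Fin T → ℝ) : ℝ :=
  √((1 / (T : ℝ)) * ∑ l, b l ^ 2)

/-- The point `1` of the interval `[ε, 1]`. -/
def rightEnd {ε : ℝ} (hε : ε ≤ 1) : Icc ε 1 := ⟨1, hε, le_rfl⟩

/-- The space `(ℓ^∞[ε,1])^T` of `T`-tuples of bounded (not necessarily measurable) functions on
`[ε, 1]`, with the topology of uniform convergence. -/
abbrev EllInfty (ε : ℝ) (T : ℕ) : Type :=
  Fin T → lp (fun _ : Icc ε 1 => ℝ) ∞

/-- Outer expectation `E^* Z` of a bounded, possibly non-measurable function `Z`: the infimum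
of the expectations of the integrable measurable functions above `Z`. -/
def outerExpectation {Ω : Type*} [MeasurableSpace Ω] (P : Measure Ω) (Z : Ω → ℝ) : ℝ :=
  sInf {a : ℝ | ∃ U : Ω → ℝ, Measurable U ∧ Integrable U P ∧ (∀ ω, Z ω ≤ U ω) ∧ a = ∫ ω, U ω ∂P}

/-- Weak convergence `X n ⇝ G` in the sense of Hoffmann-Jørgensen, for arbitrary maps `X n` into
a topological space `S`: the limit `G` is Borel measurable (with respect to the completion of its
probability space), and `E^* f(X n) → E f(G)` for all bounded continuous `f : S → ℝ`. -/
structure ConvergesWeakly {S : Type*} [TopologicalSpace S]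
    {Ω : ℕ → Type*} [∀ n, MeasurableSpace (Ω n)] (P : ∀ n, Measure (Ω n)) (X : ∀ n, Ω n → S)
    {Ω' : Type*} [MeasurableSpace Ω'] (P' : Measure Ω') (G : Ω' → S) : Prop where
  borel : ∀ U : Set S, IsOpen U → NullMeasurableSet (G ⁻¹' U) P'
  tendsto : ∀ f : S →ᵇ ℝ,
    Tendsto (fun n => outerExpectation (P n) (fun ω => f (X n ω))) atTop
      (𝓝 (∫ ω, f (G ω) ∂P'))

/-- Sequential asymptotic normality: in `(ℓ^∞[ε,1])^T`,
`{√n (βhat_n(t) - β)}_{t ∈ [ε,1]} ⇝ {t⁻¹ D B(t)}_{t ∈ [ε,1]}`, where `D` is a `T × T` matrix of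
full rank and `B` is a vector of `T` independent Brownian motions on `(Ω', P')`.
Here `X n` is the process on the left and `G` the one on the right, viewed as maps into
`(ℓ^∞[ε,1])^T`. Paths of a Brownian motion are continuous almost surely only, so `G` is
identified up to a null set. -/
structure SequentialNormality {ε : ℝ} {T : ℕ}
    {Ω : ℕ → Type*} [∀ n, MeasurableSpace (Ω n)] (P : ∀ n, Measure (Ω n))
    (βhat : ∀ n, Icc ε 1 → Ω n → Fin T → ℝ) (β : Fin T → ℝ)
    (D : Matrix (Fin T) (Fin T) ℝ)
    {Ω' : Type*} [MeasurableSpace Ω'] (P' : Measure Ω') (B : Fin T → ℝ≥0 → Ω' → ℝ) : Prop where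
  full_rank : D.rank = T
  brownian : ∀ k, IsBrownianReal (B k) P'
  indep : iIndepFun (fun (k : Fin T) (ω : Ω') (t : ℝ≥0) => B k t ω) P'
  weak_convergence : ∃ (X : ∀ n, Ω n → EllInfty ε T) (G : Ω' → EllInfty ε T),
    (∀ n ω l (t : Icc ε 1), X n ω l t = √(n : ℝ) * (βhat n t ω l - β l)) ∧
    (∀ᵐ ω ∂P', ∀ l (t : Icc ε 1),
      G ω l t = (t : ℝ)⁻¹ * (D.mulVec fun k => B k (Real.toNNReal t) ω) l) ∧
    ConvergesWeakly P X P' G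

/-- The self-normalizer
`V = (∫_{[ε,1]} (b_RMS²(t) - b_RMS²(1))² ν(dt))^{1/2}` of a path `b : [ε,1] → ℝ^T`. -/
def selfNormalizer {ε : ℝ} {T : ℕ} (hε : ε ≤ 1) (ν : Measure (Icc ε 1))
    (b : Icc ε 1 → Fin T → ℝ) : ℝ :=
  √(∫ t, (rms (b t) ^ 2 - rms (b (rightEnd hε)) ^ 2) ^ 2 ∂ν)

/-- The random variable `W = B(1) / (∫_{[ε,1]} (B(t)/t - B(1))² ν(dt))^{1/2}`. -/
def limitW {ε : ℝ} (ν : Measure (Icc ε 1)) {Ω : Type*} (B : ℝ≥0 → Ω → ℝ) (ω : Ω) : ℝ :=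
  B 1 ω / √(∫ t : Icc ε 1, (B (Real.toNNReal t) ω / (t : ℝ) - B 1 ω) ^ 2 ∂ν)

/-- The `α`-quantile `inf {x | P(Z ≤ x) ≥ α}` of a real random variable `Z`. -/
def quantile {Ω : Type*} [MeasurableSpace Ω] (P : Measure Ω) (Z : Ω → ℝ) (α : ℝ) : ℝ :=
  sInf {x : ℝ | α ≤ P.real {ω | Z ω ≤ x}}

/-- The event that the test with threshold `ζ` and critical value `q` rejects, for the estimator
process `βhat` evaluated on a sample of fixed size: `βhat_RMS²(1) < ζ² + q V`. -/
def rejectionEvent {ε : ℝ} {T : ℕ} (hε : ε ≤ 1) (ν : Measure (Icc ε 1)) (ζ q : ℝ)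
    {Ω : Type*} (βhat : Icc ε 1 → Ω → Fin T → ℝ) : Set Ω :=
  {ω | rms (βhat (rightEnd hε) ω) ^ 2 < ζ ^ 2 + q * selfNormalizer hε ν (fun t => βhat t ω)}

end

/-! With `c = n^(-1/2)` and `x` the rescaled error, `rms (β + c x)² - rms β² = c * rmsIncrement β c
x` exactly. The functional `pivotGap` is positively homogeneous, so the test rejects iff `rms β² -
ζ² + c * pivotGap (rmsIncrement β c x) < 0` (`mem_rejectionEvent_iff`).

Off the boundary, the wrong decision forces `|pivotGap|` to be of order at least `√n`. Since
`pivotGap` is bounded on bounded sets, the norm of the error must then diverge, which weak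
convergence forbids (`ConvergesWeakly.tendsto_measureReal_zero`).

On the boundary only the sign of `pivotGap` matters. As `c → 0` the increment tends, uniformly on
bounded sets, to the linear map `(2/T)⟨β, x⟩`. At the limit process this is `r W(t)/t` with `W` a
Brownian motion and `r > 0`, because `Dᵀβ ≠ 0` (`exists_brownian_pivotGap_eq`). The factor `r` does
not affect the sign, and what remains is the event that the pivot lies below its quantile. That
event has probability `α` because the pivot has no atoms: `B(1)` is Gaussian and independent of the
bridge in the denominator.

The error processes need not be measurable, so limits are obtained from portmanteau upper bounds
alone, applied to the rejection event and to its complement. -/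

/-- The lower integral of `f ^ 2`. It agrees with the Bochner integral for bounded measurable `f`
and, unlike it, is continuous for uniform convergence without any measurability. -/
noncomputable def lowerSqIntegral {ι : Type*} [MeasurableSpace ι] (ν : Measure ι) (f : ι → ℝ) : ℝ :=
  (∫⁻ t, ENNReal.ofReal (f t ^ 2) ∂ν).toReal

/-! ### Stability of the self-normalized functional under uniform perturbations. -/

section LowerSqIntegral

variable {ι : Type*} [MeasurableSpace ι] {ν : Measure ι}

lemma lowerSqIntegral_eq_integral {f : ι → ℝ} (hf : Measurable f) :
    lowerSqIntegral ν f = ∫ t, f t ^ 2 ∂ν :=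
  (integral_eq_lintegral_of_nonneg_ae (ae_of_all _ fun _ => sq_nonneg _)
    (hf.pow_const 2).aestronglyMeasurable).symm

lemma lowerSqIntegral_const_mul (c : ℝ) (f : ι → ℝ) :
    lowerSqIntegral ν (fun t => c * f t) = c ^ 2 * lowerSqIntegral ν f := by
  simp only [lowerSqIntegral, mul_pow, ENNReal.ofReal_mul (sq_nonneg c)]
  rw [lintegral_const_mul' _ _ ENNReal.ofReal_ne_top, ENNReal.toReal_mul,
    ENNReal.toReal_ofReal (sq_nonneg c)]

lemma lowerSqIntegral_le_add [IsFiniteMeasure ν] {f g : ι → ℝ} {M δ : ℝ} (hδ : 0 ≤ δ)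
    (hg : ∀ t, g t ^ 2 ≤ M) (h : ∀ t, f t ^ 2 ≤ g t ^ 2 + δ) :
    lowerSqIntegral ν f ≤ lowerSqIntegral ν g + δ * ν.real univ := by
  have hfin : ∫⁻ t, ENNReal.ofReal (g t ^ 2) ∂ν ≠ ∞ := by
    refine ((lintegral_mono fun t => ENNReal.ofReal_le_ofReal (hg t)).trans_lt ?_).ne
    rw [lintegral_const]
    exact ENNReal.mul_lt_top ENNReal.ofReal_lt_top (measure_lt_top _ _)
  have hle : ∫⁻ t, ENNReal.ofReal (f t ^ 2) ∂ν
      ≤ ∫⁻ t, ENNReal.ofReal (g t ^ 2) ∂ν + ENNReal.ofReal δ * ν univ := by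
    -- Additivity needs only one measurable summand, and the constant is one; `f` and `g` may be
    -- arbitrary.
    rw [← lintegral_const, ← lintegral_add_right _ measurable_const]
    refine lintegral_mono fun t => ?_
    rw [← ENNReal.ofReal_add (sq_nonneg _) hδ]
    exact ENNReal.ofReal_le_ofReal (h t)
  have hc : ENNReal.ofReal δ * ν univ ≠ ∞ :=
    (ENNReal.mul_lt_top ENNReal.ofReal_lt_top (measure_lt_top _ _)).ne
  have := ENNReal.toReal_mono (ENNReal.add_ne_top.2 ⟨hfin, hc⟩) hle
  rwa [ENNReal.toReal_add hfin hc, ENNReal.toReal_mul, ENNReal.toReal_ofReal hδ] at this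

lemma abs_sqrt_sub_sqrt_le {x y d : ℝ} (hd : 0 ≤ d) (h1 : x ≤ y + d) (h2 : y ≤ x + d) :
    |√x - √y| ≤ √d := by
  have key : ∀ {a b : ℝ}, a ≤ b + d → √a ≤ √b + √d := by
    intro a b h
    -- This also covers negative `b`, where `√b = 0`.
    have hb : b ≤ √b ^ 2 := by
      rcases le_total 0 b with hb | hb
      · rw [Real.sq_sqrt hb]
      · exact hb.trans (sq_nonneg _)
    refine Real.sqrt_le_iff.2 ⟨by positivity, ?_⟩
    nlinarith [Real.sq_sqrt hd, Real.sqrt_nonneg b, Real.sqrt_nonneg d]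
  rw [abs_le]
  constructor <;> linarith [key h1, key h2]

lemma abs_sqrt_lowerSqIntegral_sub_le [IsFiniteMeasure ν] {f g : ι → ℝ} {M δ : ℝ}
    (hM : 0 ≤ M) (hδ : 0 ≤ δ)
    (hf : ∀ t, |f t| ≤ M) (hg : ∀ t, |g t| ≤ M) (h : ∀ t, |f t - g t| ≤ δ) :
    |√(lowerSqIntegral ν f) - √(lowerSqIntegral ν g)| ≤ √(2 * M * δ * ν.real univ) := by
  have hsq : ∀ {a b : ℝ}, |a| ≤ M → |b| ≤ M → |a - b| ≤ δ → a ^ 2 ≤ b ^ 2 + 2 * M * δ := by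
    intro a b ha hb hab
    have h1 : a ^ 2 - b ^ 2 ≤ |a + b| * |a - b| := by
      rw [← abs_mul]; exact (le_of_eq (by ring)).trans (le_abs_self _)
    have h2 : |a + b| * |a - b| ≤ 2 * M * δ :=
      mul_le_mul ((abs_add_le a b).trans (by linarith)) hab (abs_nonneg _) (by linarith)
    linarith
  have hbd : ∀ {a : ℝ}, |a| ≤ M → a ^ 2 ≤ M ^ 2 := fun ha => sq_le_sq' (abs_le.1 ha).1 (abs_le.1 ha).2
  refine abs_sqrt_sub_sqrt_le (by positivity) ?_ ?_
  · exact lowerSqIntegral_le_add (by positivity) (fun t => hbd (hg t))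
      fun t => hsq (hf t) (hg t) (h t)
  · exact lowerSqIntegral_le_add (by positivity) (fun t => hbd (hf t))
      fun t => hsq (hg t) (hf t) (by rw [abs_sub_comm]; exact h t)

/-- The path functional `f(a) - q (∫ (f(t) - f(a))² ν(dt))^{1/2}`. -/
noncomputable def pivotGap (ν : Measure ι) (a : ι) (q : ℝ) (f : ι → ℝ) : ℝ :=
  f a - q * √(lowerSqIntegral ν fun t => f t - f a)

lemma pivotGap_zero (a : ι) (q : ℝ) : pivotGap ν a q (fun _ => 0) = 0 := by
  simp [pivotGap, lowerSqIntegral]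

lemma pivotGap_const_mul (a : ι) (q : ℝ) {c : ℝ} (hc : 0 ≤ c) (f : ι → ℝ) :
    pivotGap ν a q (fun t => c * f t) = c * pivotGap ν a q f := by
  simp only [pivotGap, ← mul_sub, lowerSqIntegral_const_mul, Real.sqrt_mul (sq_nonneg c),
    Real.sqrt_sq hc]
  ring

/-- Centering at `a` doubles both the bound and the distance, whence `8 M δ = 2 (2M)(2δ)`. The
modulus is only Hölder of order 1/2, because of the square root at a possibly vanishing integral. -/
lemma abs_pivotGap_sub_le [IsFiniteMeasure ν] (a : ι) (q : ℝ) {f g : ι → ℝ} {M δ : ℝ}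
    (hM : 0 ≤ M) (hδ : 0 ≤ δ)
    (hf : ∀ t, |f t| ≤ M) (hg : ∀ t, |g t| ≤ M) (h : ∀ t, |f t - g t| ≤ δ) :
    |pivotGap ν a q f - pivotGap ν a q g| ≤ δ + |q| * √(8 * M * δ * ν.real univ) := by
  have hV := abs_sqrt_lowerSqIntegral_sub_le (ν := ν) (f := fun t => f t - f a)
    (g := fun t => g t - g a) (M := 2 * M) (δ := 2 * δ) (by positivity) (by positivity)
    (fun t => (abs_sub _ _).trans (by linarith [hf t, hf a]))
    (fun t => (abs_sub _ _).trans (by linarith [hg t, hg a]))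
    (fun t => by
      rw [show f t - f a - (g t - g a) = (f t - g t) - (f a - g a) by ring]
      exact (abs_sub _ _).trans (by linarith [h t, h a]))
  rw [show 2 * (2 * M) * (2 * δ) = 8 * M * δ by ring] at hV
  unfold pivotGap
  rw [show ∀ x y u v : ℝ, x - q * u - (y - q * v) = (x - y) - q * (u - v) by intros; ring]
  refine (abs_sub _ _).trans (add_le_add (h a) ?_)
  rw [abs_mul]
  exact mul_le_mul_of_nonneg_left hV (abs_nonneg q)

end LowerSqIntegral

/-! ### Portmanteau bounds for non-measurable maps. -/

section Portmanteau

/-- Markov's inequality at level 1 for each measurable majorant of `Z`; thus `E` need not be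
measurable. -/
lemma measureReal_le_outerExpectation {Ω : Type*} [MeasurableSpace Ω] {P : Measure Ω}
    [IsProbabilityMeasure P] {Z : Ω → ℝ} {M : ℝ} (h0 : ∀ ω, 0 ≤ Z ω) (hM : ∀ ω, Z ω ≤ M)
    {E : Set Ω} (hE : ∀ ω ∈ E, 1 ≤ Z ω) : P.real E ≤ outerExpectation P Z := by
  refine le_csInf ⟨_, fun _ => M, measurable_const, integrable_const M, hM, rfl⟩ ?_
  rintro _ ⟨U, -, hU, hZU, rfl⟩
  have hmarkov := mul_meas_ge_le_integral_of_nonneg (μ := P)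
    (ae_of_all _ fun ω => (h0 ω).trans (hZU ω)) hU 1
  rw [one_mul] at hmarkov
  exact (measureReal_mono fun ω hω => (hE ω hω).trans (hZU ω)).trans hmarkov

variable {S : Type*} [PseudoEMetricSpace S]
  {Ω : ℕ → Type*} [∀ n, MeasurableSpace (Ω n)] {P : ∀ n, Measure (Ω n)} {X : ∀ n, Ω n → S}
  {Ω' : Type*} [MeasurableSpace Ω'] {P' : Measure Ω'} {G : Ω' → S}

lemma ConvergesWeakly.nullMeasurable_comp (h : ConvergesWeakly P X P' G) {f : S → ℝ}
    (hf : Continuous f) : AEMeasurable (fun ω => f (G ω)) P' := by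
  refine NullMeasurable.aemeasurable fun s hs => ?_
  borelize S
  induction s, hs using MeasurableSpace.induction_on_inter
    (borel_eq_generateFrom_isClosed (α := ℝ) ▸ BorelSpace.measurable_eq) isPiSystem_isClosed with
  | empty => simp
  | basic s hs =>
    exact (h.borel _ (hs.preimage hf).isOpen_compl).of_compl
  | compl s _ hs => exact hs.compl
  | iUnion s _ _ hs => rw [preimage_iUnion]; exact .iUnion hs

/-- The upper bound of the portmanteau theorem, for events that are eventually contained in the
preimages of each of a decreasing sequence of closed sets. -/
lemma ConvergesWeakly.eventually_measureReal_le [∀ n, IsProbabilityMeasure (P n)]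
    [IsProbabilityMeasure P'] (h : ConvergesWeakly P X P' G)
    {E : ∀ n, Set (Ω n)} {C : ℕ → Set S} (hC : ∀ k, IsClosed (C k)) (hanti : Antitone C)
    (hE : ∀ k, ∀ᶠ n in atTop, E n ⊆ X n ⁻¹' C k) {b : ℝ}
    (hb : P'.real (G ⁻¹' ⋂ k, C k) < b) : ∀ᶠ n in atTop, (P n).real (E n) ≤ b := by
  have hpos : ∀ k : ℕ, (0 : ℝ) < 1 / ((k : ℝ) + 1) := fun k => Nat.one_div_pos_of_nat
  have hnull : ∀ k, NullMeasurableSet (G ⁻¹' C k) P' := fun k => by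
    exact (h.borel _ (hC k).isOpen_compl).of_compl
  have hlim : Tendsto (fun k => P'.real (G ⁻¹' C k)) atTop (𝓝 (P'.real (G ⁻¹' ⋂ k, C k))) := by
    rw [preimage_iInter]
    exact (ENNReal.tendsto_toReal (measure_ne_top _ _)).comp
      (tendsto_measure_iInter_atTop hnull (fun i j hij => preimage_mono (hanti hij))
        ⟨0, measure_ne_top _ _⟩)
  -- The choices are successive: a closed set `C k` of limit mass below `b`, then a continuous
  -- majorant of its indicator with integral still below `b`, then `n` large.
  obtain ⟨k, hk⟩ := (hlim.eventually_lt_const hb).exists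
  let φ : ℕ → S →ᵇ ℝ := fun j => BoundedContinuousFunction.comp (fun x : ℝ≥0 => (x : ℝ))
    (LipschitzWith.mk_one fun _ _ => le_rfl) (thickenedIndicator (hpos j) (C k))
  have hφ : ∀ j x, φ j x = (thickenedIndicator (hpos j) (C k) x : ℝ) := fun _ _ => rfl
  have hφ0 : ∀ j x, 0 ≤ φ j x := fun j x => (hφ j x).symm ▸ NNReal.coe_nonneg _
  have hφ1 : ∀ j x, φ j x ≤ 1 := fun j x => by
    rw [hφ]; exact_mod_cast thickenedIndicator_le_one (hpos j) (C k) x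
  have hint : Tendsto (fun j => ∫ ω, φ j (G ω) ∂P') atTop (𝓝 (P'.real (G ⁻¹' C k))) := by
    have hind : P'.real (G ⁻¹' C k) = ∫ ω, (C k).indicator (fun _ => (1 : ℝ)) (G ω) ∂P' := by
      have : (fun ω => (C k).indicator (fun _ => (1 : ℝ)) (G ω))
          = (G ⁻¹' C k).indicator fun _ => (1 : ℝ) := by
        rfl
      rw [this, integral_indicator₀ (hnull k)]
      simp
    rw [hind]
    refine tendsto_integral_of_dominated_convergence (fun _ => 1)
      (fun j => (h.nullMeasurable_comp (φ j).continuous).aestronglyMeasurable)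
      (integrable_const _) (fun j => ae_of_all _ fun ω => ?_) (ae_of_all _ fun ω => ?_)
    · rw [Real.norm_of_nonneg (hφ0 _ _)]; exact hφ1 _ _
    · have := (tendsto_pi_nhds.1 (thickenedIndicator_tendsto_indicator_closure hpos
        tendsto_one_div_add_atTop_nhds_zero_nat (C k))) (G ω)
      rw [(hC k).closure_eq] at this
      have h2 := (NNReal.continuous_coe.tendsto _).comp this
      have h3 : (C k).indicator (fun _ => (1 : ℝ)) (G ω)
          = NNReal.toReal ((C k).indicator (fun _ => 1) (G ω)) := by
        by_cases hm : G ω ∈ C k <;> simp [hm]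
      rw [h3]
      exact h2
  obtain ⟨j, hj⟩ := (hint.eventually_lt_const hk).exists
  filter_upwards [(h.tendsto (φ j)).eventually_lt_const hj, hE k] with n hn hEn
  refine (measureReal_le_outerExpectation (fun ω => hφ0 j _) (fun ω => hφ1 j _)
    fun ω hω => ?_).trans hn.le
  rw [hφ, thickenedIndicator_one (hpos j) (C k) (hEn hω)]
  simp

end Portmanteau

/-! ### Path integrals as limits of finite sums. -/

section RiemannSums

variable {ι : Type*} [MeasurableSpace ι] (ν : Measure ι) [IsFiniteMeasure ν]

lemma integral_comp_simpleFunc {κ : Type*} (s : SimpleFunc ι κ) (h : κ → ℝ) :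
    ∫ t, h (s t) ∂ν = ∑ v ∈ s.range, ν.real (s ⁻¹' {v}) * h v := by
  classical
  have hsum : ∀ t, h (s t) = ∑ v ∈ s.range, (s ⁻¹' {v}).indicator (fun _ => h v) t := by
    intro t
    rw [Finset.sum_eq_single_of_mem (s t) (s.mem_range_self t)]
    · simp
    · intro v _ hv
      exact indicator_of_notMem (fun hm => hv hm.symm) _
  simp_rw [hsum]
  rw [integral_finsetSum _ fun v _ =>
    (integrable_const (h v)).indicator (s.measurableSet_fiber v)]
  refine Finset.sum_congr rfl fun v _ => ?_
  rw [integral_indicator_const _ (s.measurableSet_fiber v), smul_eq_mul]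

lemma tendsto_integral_comp_simpleFunc [TopologicalSpace ι] [CompactSpace ι] [BorelSpace ι]
    {s : ℕ → SimpleFunc ι ι} (hs : ∀ t, Tendsto (fun n => s n t) atTop (𝓝 t)) {f : ι → ℝ}
    (hf : Continuous f) :
    Tendsto (fun n => ∫ t, f (s n t) ∂ν) atTop (𝓝 (∫ t, f t ∂ν)) := by
  obtain ⟨C, hC⟩ := isCompact_univ.exists_bound_of_continuousOn hf.continuousOn
  exact tendsto_integral_of_dominated_convergence (fun _ => C)
    (fun n => ((s n).map f).measurable.aestronglyMeasurable) (integrable_const C)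
    (fun n => ae_of_all _ fun t => hC _ (mem_univ _))
    (ae_of_all _ fun t => (hf.tendsto t).comp (hs t))

lemma exists_simpleFunc_tendsto_id (ε : ℝ) :
    ∃ s : ℕ → SimpleFunc (Icc ε 1) (Icc ε 1), ∀ t, Tendsto (fun n => s n t) atTop (𝓝 t) :=
  ⟨_, (stronglyMeasurable_id (α := Icc ε 1)).tendsto_approx⟩

end RiemannSums

/-- The process `B(t)/t - B(1)`, indexed by `[ε, 1]`. -/
noncomputable def scaledBridge {Ω : Type*} (ε : ℝ) (B : ℝ≥0 → Ω → ℝ) (t : Icc ε 1) (ω : Ω) : ℝ :=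
  B (Real.toNNReal t) ω / (t : ℝ) - B 1 ω

namespace ProbabilityTheory

lemma continuous_scaledBridge {Ω : Type*} {B : ℝ≥0 → Ω → ℝ} {ε : ℝ} (hε : 0 < ε) {ω : Ω} (h : Continuous (B · ω)) :
    Continuous fun t : Icc ε 1 => scaledBridge ε B t ω := by
  unfold scaledBridge
  refine (Continuous.div ?_ continuous_subtype_val fun t => (hε.trans_le t.2.1).ne').sub
    continuous_const
  exact h.comp (continuous_real_toNNReal.comp continuous_subtype_val)

variable {Ω : Type*} [MeasurableSpace Ω] {P : Measure Ω} {B : ℝ≥0 → Ω → ℝ} {ε : ℝ}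

/-! ### Quantiles of atomless laws. -/

section Quantile

/-- Without atoms the distribution function is continuous: it attains `α`, and its superlevel set is
closed and contains its infimum. -/
lemma measureReal_Iic_sInf {μ : Measure ℝ} [IsProbabilityMeasure μ] (hμ : ∀ x, μ {x} = 0)
    {α : ℝ} (hα0 : 0 < α) (hα1 : α < 1) : μ.real (Iic (sInf {x | α ≤ μ.real (Iic x)})) = α := by
  have hcont : Continuous (cdf μ) := by
    refine continuous_iff_continuousAt.2 fun x => ?_
    rw [(monotone_cdf μ).continuousAt_iff_leftLim_eq_rightLim, StieltjesFunction.rightLim_eq]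
    have h := (cdf μ).measure_singleton x
    rw [measure_cdf, hμ, eq_comm, ENNReal.ofReal_eq_zero, sub_nonpos] at h
    exact le_antisymm ((monotone_cdf μ).leftLim_le le_rfl) h
  obtain ⟨x, hx⟩ := mem_range_of_exists_le_of_exists_ge hcont
    ((tendsto_cdf_atBot μ).eventually_le_const hα0).exists
    ((tendsto_cdf_atTop μ).eventually_const_le hα1).exists
  obtain ⟨y, hy⟩ := ((tendsto_cdf_atBot μ).eventually_lt_const hα0).exists
  simp_rw [← cdf_eq_real]
  have hbdd : BddBelow {x | α ≤ cdf μ x} :=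
    ⟨y, fun z hz => le_of_not_gt fun hzy => (hz.trans (monotone_cdf μ hzy.le)).not_gt hy⟩
  refine le_antisymm ((monotone_cdf μ (csInf_le hbdd hx.ge)).trans hx.le) ?_
  exact (isClosed_le continuous_const hcont).csInf_mem ⟨x, hx.ge⟩ hbdd

end Quantile

/-! ### The law of the pivot. -/

section Bridge

/-- The integrals on the left do not involve `B`. Hence a path functional that is an almost sure
limit of finite-dimensional ones has the same law for every Brownian motion. -/
lemma IsPreBrownianReal.tendsto_integral_projectiveFamily (hB : IsPreBrownianReal B P)
    {E : Type*} [TopologicalSpace E] [MeasurableSpace E] [OpensMeasurableSpace E]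
    {I : ℕ → Finset ℝ≥0} {g : ∀ n, (I n → ℝ) → E} (hg : ∀ n, Measurable (g n)) {Y : Ω → E}
    (hY : AEMeasurable Y P)
    (hlim : ∀ᵐ ω ∂P, Tendsto (fun n => g n ((I n).restrict (B · ω))) atTop (𝓝 (Y ω)))
    (φ : E →ᵇ ℝ) :
    Tendsto (fun n => ∫ x, φ (g n x) ∂BrownianReal.projectiveFamily (I n)) atTop
      (𝓝 (∫ y, φ y ∂P.map Y)) := by
  have := hB.isGaussianProcess.isProbabilityMeasure
  have hφ : Measurable φ := φ.continuous.measurable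
  rw [integral_map hY hφ.aestronglyMeasurable]
  have heq : ∀ n, ∫ x, φ (g n x) ∂BrownianReal.projectiveFamily (I n)
      = ∫ ω, φ (g n ((I n).restrict (B · ω))) ∂P := fun n => by
    rw [← (hB.hasLaw (I n)).map_eq]
    exact integral_map (hB.hasLaw (I n)).aemeasurable (hφ.comp (hg n)).aestronglyMeasurable
  simp_rw [heq]
  refine tendsto_integral_of_dominated_convergence (fun _ => ‖φ‖)
    (fun n => ((hφ.comp (hg n)).comp_aemeasurable (hB.hasLaw (I n)).aemeasurable).aestronglyMeasurable)
    (integrable_const _) (fun n => ae_of_all _ fun ω => φ.norm_coe_le_norm _) ?_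
  filter_upwards [hlim] with ω hω
  exact (φ.continuous.tendsto _).comp hω

lemma IsPreBrownianReal.aemeasurable_scaledBridge (hB : IsPreBrownianReal B P) (t : Icc ε 1) :
    AEMeasurable (scaledBridge ε B t) P :=
  ((hB.aemeasurable _).div_const _).sub (hB.aemeasurable _)

lemma IsPreBrownianReal.covariance_scaledBridge (hε : 0 < ε) (hB : IsPreBrownianReal B P)
    (r : ℝ≥0) (t : Icc ε 1) :
    cov[B r, scaledBridge ε B t; P] = (t : ℝ)⁻¹ * min (r : ℝ) t - min (r : ℝ) 1 := by
  have := hB.isGaussianProcess.isProbabilityMeasure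
  have hL : ∀ t, MemLp (B t) 2 P := fun t => (hB.isGaussianProcess.hasGaussianLaw_eval t).memLp_two
  have ht : (0 : ℝ) < t := hε.trans_le t.2.1
  have h1 : scaledBridge ε B t
      = fun ω => (fun ω => (t : ℝ)⁻¹ * B (Real.toNNReal t) ω) ω - B 1 ω := by
    ext ω; simp only [scaledBridge]; ring
  rw [h1, covariance_fun_sub_right (hL _) ((hL _).const_mul _) (hL _),
    covariance_const_mul_right, hB.covariance_eval, hB.covariance_eval]
  simp [Real.coe_toNNReal _ ht.le]

lemma IsPreBrownianReal.covariance_one_scaledBridge (hε : 0 < ε) (hB : IsPreBrownianReal B P)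
    (t : Icc ε 1) : cov[B 1, scaledBridge ε B t; P] = 0 := by
  have ht : (0 : ℝ) < t := hε.trans_le t.2.1
  rw [hB.covariance_scaledBridge hε, NNReal.coe_one, min_self, min_eq_right t.2.2,
    inv_mul_cancel₀ ht.ne', sub_self]

lemma IsPreBrownianReal.hasGaussianLaw_scaledBridge (hB : IsPreBrownianReal B P) (t : Icc ε 1) :
    HasGaussianLaw (scaledBridge ε B t) P := by
  refine IsGaussianProcess.hasGaussianLaw_eval (X := scaledBridge ε B)
    (hB.isGaussianProcess.of_isGaussianProcess fun t => ?_) t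
  exact ⟨{Real.toNNReal t, 1},
    { toFun x := x ⟨Real.toNNReal t, by simp⟩ / (t : ℝ) - x ⟨1, by simp⟩
      map_add' x y := by simp; ring
      map_smul' c x := by simp; ring }, by simp [scaledBridge]⟩

lemma IsPreBrownianReal.variance_scaledBridge (hε : 0 < ε) (hB : IsPreBrownianReal B P)
    (t : Icc ε 1) : Var[scaledBridge ε B t; P] = (t : ℝ)⁻¹ - 1 := by
  have := hB.isGaussianProcess.isProbabilityMeasure
  have hL : ∀ t, MemLp (B t) 2 P := fun t => (hB.isGaussianProcess.hasGaussianLaw_eval t).memLp_two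
  have ht : (0 : ℝ) < t := hε.trans_le t.2.1
  have h1 : scaledBridge ε B t
      = fun ω => (fun ω => (t : ℝ)⁻¹ * B (Real.toNNReal t) ω) ω - B 1 ω := by
    ext ω; simp only [scaledBridge]; ring
  have h2 := hB.hasGaussianLaw_scaledBridge t
  rw [← covariance_self h2.aemeasurable]
  conv_lhs => arg 1; rw [h1]
  rw [covariance_fun_sub_left ((hL _).const_mul _) (hL _) h2.memLp_two,
    covariance_const_mul_left, hB.covariance_one_scaledBridge hε, hB.covariance_scaledBridge hε,
    Real.coe_toNNReal _ ht.le, min_self, min_eq_left t.2.2]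
  field_simp
  ring

/-- The two are jointly Gaussian and uncorrelated, as `t⁻¹ min(1, t) - 1 = 0`. The index type `Unit`
turns `B 1` into a process. -/
lemma IsPreBrownianReal.indepFun_one_scaledBridge (hε : 0 < ε) (hB : IsPreBrownianReal B P) :
    IndepFun (B 1) (fun ω (t : Icc ε 1) => scaledBridge ε B t ω) P := by
  have h : IndepFun (fun ω (_ : Unit) => B 1 ω) (fun ω (t : Icc ε 1) => scaledBridge ε B t ω) P := by
    refine IsGaussianProcess.indepFun_of_covariance_eq_zero ?_ (fun _ => hB.aemeasurable 1)
      hB.aemeasurable_scaledBridge fun _ t => hB.covariance_one_scaledBridge hε t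
    apply hB.isGaussianProcess.of_isGaussianProcess
    rintro (_ | t)
    · exact ⟨{1},
        { toFun x := x ⟨1, by simp⟩
          map_add' x y := by simp
          map_smul' c x := by simp }, by simp⟩
    · exact ⟨{Real.toNNReal t, 1},
        { toFun x := x ⟨Real.toNNReal t, by simp⟩ / (t : ℝ) - x ⟨1, by simp⟩
          map_add' x y := by simp; ring
          map_smul' c x := by simp; ring }, by simp [scaledBridge]⟩
  exact h.comp (φ := fun x : Unit → ℝ => x ()) (measurable_pi_apply _) measurable_id

variable (ν : Measure (Icc ε 1)) [IsFiniteMeasure ν]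

lemma IsBrownianReal.tendsto_sum_scaledBridge (hε : 0 < ε) (hB : IsBrownianReal B P)
    {s : ℕ → SimpleFunc (Icc ε 1) (Icc ε 1)} (hs : ∀ t, Tendsto (fun n => s n t) atTop (𝓝 t)) :
    ∀ᵐ ω ∂P, Tendsto
      (fun n => ∑ v ∈ (s n).range, ν.real (s n ⁻¹' {v}) * scaledBridge ε B v ω ^ 2) atTop
      (𝓝 (∫ t, scaledBridge ε B t ω ^ 2 ∂ν)) := by
  filter_upwards [hB.cont] with ω hω
  have := tendsto_integral_comp_simpleFunc ν hs ((continuous_scaledBridge hε hω).pow 2)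
  refine this.congr fun n => ?_
  exact integral_comp_simpleFunc ν (s n) fun t => scaledBridge ε B t ω ^ 2

lemma IsBrownianReal.aemeasurable_integral_scaledBridge (hε : 0 < ε) (hB : IsBrownianReal B P) :
    AEMeasurable (fun ω => ∫ t, scaledBridge ε B t ω ^ 2 ∂ν) P := by
  obtain ⟨s, hs⟩ := exists_simpleFunc_tendsto_id ε
  refine aemeasurable_of_tendsto_metrizable_ae atTop (fun n => ?_)
    (hB.tendsto_sum_scaledBridge ν hε hs)
  exact Finset.aemeasurable_fun_sum _ fun v _ =>
    ((hB.aemeasurable_scaledBridge v).pow_const 2).const_mul _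

lemma IsBrownianReal.indepFun_one_integral_scaledBridge (hε : 0 < ε) (hB : IsBrownianReal B P) :
    IndepFun (B 1) (fun ω => ∫ t, scaledBridge ε B t ω ^ 2 ∂ν) P := by
  obtain ⟨s, hs⟩ := exists_simpleFunc_tendsto_id ε
  let S : ℕ → (Icc ε 1 → ℝ) → ℝ := fun n u => ∑ v ∈ (s n).range, ν.real (s n ⁻¹' {v}) * u v ^ 2
  have hS : ∀ n, Measurable (S n) := fun n => by fun_prop
  -- The integral is not evidently measurable for the product σ-algebra on paths; this limsup is,
  -- and it agrees with the integral almost surely.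
  have hlim : Measurable fun u => limsup (fun n => S n u) atTop := .limsup hS
  refine ((hB.indepFun_one_scaledBridge hε).comp measurable_id hlim).congr ae_eq_rfl ?_
  filter_upwards [hB.tendsto_sum_scaledBridge ν hε hs] with ω hω
  exact hω.limsup_eq

/-- Some `t₀ < 1` has only neighbourhoods of positive `ν`-measure. The bridge there is Gaussian of
variance `t₀⁻¹ - 1 > 0`, so almost surely nonzero, and by continuity nonzero nearby. -/
lemma IsBrownianReal.integral_scaledBridge_pos (hε : 0 < ε) (hε1 : ε ≤ 1)
    (hν : ν {rightEnd hε1}ᶜ ≠ 0) (hB : IsBrownianReal B P) :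
    ∀ᵐ ω ∂P, 0 < ∫ t, scaledBridge ε B t ω ^ 2 ∂ν := by
  obtain ⟨t₀, ht₀, hpos⟩ := exists_mem_forall_mem_nhdsWithin_pos_measure hν
  have h0 : (0 : ℝ) < t₀ := hε.trans_le t₀.2.1
  have h1 : (t₀ : ℝ) < 1 := lt_of_le_of_ne t₀.2.2 fun h => ht₀ (Subtype.ext h)
  have hprob := hB.isGaussianProcess.isProbabilityMeasure
  have hne : ∀ᵐ ω ∂P, scaledBridge ε B t₀ ω ≠ 0 := by
    have hG := hB.hasGaussianLaw_scaledBridge t₀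
    have hvar : Var[scaledBridge ε B t₀; P].toNNReal ≠ 0 := by
      rw [hB.variance_scaledBridge hε, Ne, Real.toNNReal_eq_zero, not_le, sub_pos]
      exact (one_lt_inv₀ h0).2 h1
    have := nullSingletonClass_gaussianReal (μ := P[scaledBridge ε B t₀]) hvar
    have hz : P.map (scaledBridge ε B t₀) {0} = 0 := by
      rw [hG.map_eq_gaussianReal]; exact measure_singleton 0
    rw [Measure.map_apply_of_aemeasurable hG.aemeasurable (measurableSet_singleton 0)] at hz
    exact measure_eq_zero_iff_ae_notMem.1 hz
  filter_upwards [hB.cont, hne] with ω hω hne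
  have hc := (continuous_scaledBridge hε hω).pow 2
  obtain ⟨C, hC⟩ := isCompact_univ.exists_bound_of_continuousOn hc.continuousOn
  have hint : Integrable (fun t => scaledBridge ε B t ω ^ 2) ν :=
    .of_bound hc.aestronglyMeasurable C (ae_of_all _ fun t => hC t (mem_univ _))
  rw [integral_pos_iff_support_of_nonneg (fun _ => sq_nonneg _) hint]
  refine hpos _ (mem_nhdsWithin_of_mem_nhds ?_)
  exact hc.isOpen_support.mem_nhds (pow_ne_zero 2 hne)

/-- By independence and Fubini, the integral may be frozen; the section is then a single point, null
for the Gaussian `B 1`. -/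
lemma IsBrownianReal.measure_one_eq_mul_sqrt (hε : 0 < ε) (hB : IsBrownianReal B P) (x : ℝ) :
    P {ω | B 1 ω = x * √(∫ t, scaledBridge ε B t ω ^ 2 ∂ν)} = 0 := by
  have := hB.isGaussianProcess.isProbabilityMeasure
  have hI := hB.aemeasurable_integral_scaledBridge ν hε
  have h1 := hB.aemeasurable 1
  have hprod := (indepFun_iff_map_prod_eq_prod_map_map h1 hI).1
    (hB.indepFun_one_integral_scaledBridge ν hε)
  have hS : MeasurableSet {p : ℝ × ℝ | p.1 = x * √p.2} :=
    measurableSet_eq_fun measurable_fst (by fun_prop)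
  have hmap := Measure.map_apply_of_aemeasurable (h1.prodMk hI) hS
  rw [show {ω | B 1 ω = x * √(∫ t, scaledBridge ε B t ω ^ 2 ∂ν)}
    = (fun ω => (B 1 ω, ∫ t, scaledBridge ε B t ω ^ 2 ∂ν)) ⁻¹' {p : ℝ × ℝ | p.1 = x * √p.2} from rfl,
    ← hmap, hprod, (hB.hasLaw_eval 1).map_eq, Measure.prod_apply_symm hS]
  have := nullSingletonClass_gaussianReal (μ := 0) (one_ne_zero (α := ℝ≥0))
  have hz : ∀ y : ℝ, gaussianReal 0 1 ((fun a => (a, y)) ⁻¹' {p : ℝ × ℝ | p.1 = x * √p.2}) = 0 :=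
    fun y => measure_singleton (x * √y)
  simp_rw [hz, lintegral_zero]

lemma IsBrownianReal.ae_limitW_le_iff (hε : 0 < ε) (hε1 : ε ≤ 1)
    (hν : ν {rightEnd hε1}ᶜ ≠ 0) (hB : IsBrownianReal B P) :
    ∀ᵐ ω ∂P, ∀ x, (limitW ν B ω ≤ x ↔ B 1 ω ≤ x * √(∫ t, scaledBridge ε B t ω ^ 2 ∂ν)) := by
  filter_upwards [hB.integral_scaledBridge_pos ν hε hε1 hν] with ω hω x
  exact div_le_iff₀ (Real.sqrt_pos.2 hω)

/-- The distribution function of the pivotal variable takes the value `α` at the `α`-quantile. -/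
lemma IsBrownianReal.measureReal_le_quantile (hε : 0 < ε) (hε1 : ε ≤ 1)
    (hν : ν {rightEnd hε1}ᶜ ≠ 0) (hB : IsBrownianReal B P) {α : ℝ} (hα0 : 0 < α) (hα1 : α < 1) :
    P.real {ω | B 1 ω ≤ quantile P (limitW ν B) α * √(∫ t, scaledBridge ε B t ω ^ 2 ∂ν)} = α := by
  have := hB.isGaussianProcess.isProbabilityMeasure
  have hle := hB.ae_limitW_le_iff ν hε hε1 hν
  have hW : AEMeasurable (limitW ν B) P :=
    (hB.aemeasurable 1).div (hB.aemeasurable_integral_scaledBridge ν hε).sqrt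
  have hcdf : ∀ x, P.real {ω | limitW ν B ω ≤ x} = (P.map (limitW ν B)).real (Iic x) := fun x =>
    (map_measureReal_apply_of_aemeasurable hW measurableSet_Iic).symm
  have hatom : ∀ x, P.map (limitW ν B) {x} = 0 := by
    intro x
    rw [Measure.map_apply_of_aemeasurable hW (measurableSet_singleton x)]
    refine measure_mono_null_ae ?_ (hB.measure_one_eq_mul_sqrt ν hε x)
    filter_upwards [hB.integral_scaledBridge_pos ν hε hε1 hν] with ω hω hx
    exact (div_eq_iff (Real.sqrt_pos.2 hω).ne').1 hx
  have hprob : IsProbabilityMeasure (P.map (limitW ν B)) := Measure.isProbabilityMeasure_map hW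
  have hset : {ω | B 1 ω ≤ quantile P (limitW ν B) α * √(∫ t, scaledBridge ε B t ω ^ 2 ∂ν)}
      =ᵐ[P] {ω | limitW ν B ω ≤ quantile P (limitW ν B) α} := by
    filter_upwards [hle] with ω hω using propext (hω _).symm
  rw [measureReal_congr hset, hcdf]
  unfold quantile
  simp_rw [hcdf]
  exact measureReal_Iic_sInf hatom hα0 hα1

lemma IsBrownianReal.measureReal_ge_quantile (hε : 0 < ε) (hε1 : ε ≤ 1)
    (hν : ν {rightEnd hε1}ᶜ ≠ 0) (hB : IsBrownianReal B P) {α : ℝ} (hα0 : 0 < α) (hα1 : α < 1) :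
    P.real {ω | quantile P (limitW ν B) α * √(∫ t, scaledBridge ε B t ω ^ 2 ∂ν) ≤ B 1 ω}
      = 1 - α := by
  have := hB.isGaussianProcess.isProbabilityMeasure
  have hq := hB.measureReal_le_quantile ν hε hε1 hν hα0 hα1
  set q := quantile P (limitW ν B) α
  rw [← hq, ← probReal_compl_eq_one_sub₀]
  · refine measureReal_congr ?_
    have hne := measure_eq_zero_iff_ae_notMem.1
      (hB.measure_one_eq_mul_sqrt ν hε q)
    filter_upwards [hne] with ω hω
    exact propext ⟨fun h => not_le.2 (lt_of_le_of_ne h (Ne.symm hω)),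
      fun h => (lt_of_not_ge (α := ℝ) h).le⟩
  · exact nullMeasurableSet_le (hB.aemeasurable 1)
      ((hB.aemeasurable_integral_scaledBridge ν hε).sqrt.const_mul _)

/-- The joint law of `B(1)` and `∫ (B(t)/t - B(1))² ν(dt)` does not depend on the Brownian motion. -/
lemma IsBrownianReal.map_one_integral_scaledBridge_eq (hε : 0 < ε) (hB : IsBrownianReal B P)
    {Ω' : Type*} [MeasurableSpace Ω'] {P' : Measure Ω'} {B' : ℝ≥0 → Ω' → ℝ}
    (hB' : IsBrownianReal B' P') :
    P.map (fun ω => (B 1 ω, ∫ t, scaledBridge ε B t ω ^ 2 ∂ν))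
      = P'.map (fun ω => (B' 1 ω, ∫ t, scaledBridge ε B' t ω ^ 2 ∂ν)) := by
  classical
  have := hB.isGaussianProcess.isProbabilityMeasure
  have := hB'.isGaussianProcess.isProbabilityMeasure
  obtain ⟨s, hs⟩ := exists_simpleFunc_tendsto_id ε
  -- The grid and the sums depend only on `s` and `ν`, so both laws are limits of one and the same
  -- sequence.
  let I : ℕ → Finset ℝ≥0 := fun n =>
    insert 1 ((s n).range.image fun v : Icc ε 1 => Real.toNNReal v)
  have hI1 : ∀ n, 1 ∈ I n := fun n => Finset.mem_insert_self _ _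
  have hIv : ∀ n, ∀ v ∈ (s n).range, Real.toNNReal v ∈ I n := fun n v hv =>
    Finset.mem_insert_of_mem (Finset.mem_image_of_mem _ hv)
  let g : ∀ n, (I n → ℝ) → ℝ × ℝ := fun n x => (x ⟨1, hI1 n⟩,
    ∑ v ∈ (s n).range.attach, ν.real (s n ⁻¹' {v.1}) *
      (x ⟨Real.toNNReal v.1, hIv n v.1 v.2⟩ / (v.1 : ℝ) - x ⟨1, hI1 n⟩) ^ 2)
  have hg : ∀ n, Measurable (g n) := fun n => by fun_prop
  have hgx : ∀ n (x : ℝ≥0 → ℝ), g n ((I n).restrict x) = (x 1, ∑ v ∈ (s n).range,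
      ν.real (s n ⁻¹' {v}) * (x (Real.toNNReal v) / (v : ℝ) - x 1) ^ 2) := fun n x =>
    Prod.ext rfl (Finset.sum_attach (s n).range fun v =>
      ν.real (s n ⁻¹' {v}) * (x (Real.toNNReal v) / (v : ℝ) - x 1) ^ 2)
  have hY : AEMeasurable (fun ω => (B 1 ω, ∫ t, scaledBridge ε B t ω ^ 2 ∂ν)) P :=
    (hB.aemeasurable 1).prodMk (hB.aemeasurable_integral_scaledBridge ν hε)
  have hY' : AEMeasurable (fun ω => (B' 1 ω, ∫ t, scaledBridge ε B' t ω ^ 2 ∂ν)) P' :=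
    (hB'.aemeasurable 1).prodMk (hB'.aemeasurable_integral_scaledBridge ν hε)
  have := Measure.isProbabilityMeasure_map hY
  have := Measure.isProbabilityMeasure_map hY'
  refine ext_of_forall_integral_eq_of_IsFiniteMeasure fun φ => tendsto_nhds_unique
    (hB.tendsto_integral_projectiveFamily hg hY ?_ φ)
    (hB'.tendsto_integral_projectiveFamily hg hY' ?_ φ)
  · filter_upwards [hB.tendsto_sum_scaledBridge ν hε hs] with ω hω
    simp_rw [hgx]
    exact tendsto_const_nhds.prodMk_nhds hω
  · filter_upwards [hB'.tendsto_sum_scaledBridge ν hε hs] with ω hω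
    simp_rw [hgx]
    exact tendsto_const_nhds.prodMk_nhds hω

end Bridge

/-! ### Unit combinations of independent Brownian motions. -/

section LinearCombination

lemma IsBrownianReal.linear_combination {ι : Type*} [Fintype ι] {B : ι → ℝ≥0 → Ω → ℝ}
    (hB : ∀ k, IsBrownianReal (B k) P)
    (hind : iIndepFun (fun (k : ι) (ω : Ω) (t : ℝ≥0) => B k t ω) P) {c : ι → ℝ}
    (hc : ∑ k, c k ^ 2 = 1) : IsBrownianReal (fun t ω => ∑ k, c k * B k t ω) P := by
  classical
  have hprob := hind.isProbabilityMeasure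
  have hGP : ∀ k, IsGaussianProcess (B k) P := fun k =>
    IsPreBrownianReal.isGaussianProcess (hB k).toIsPreBrownianReal
  have hL : ∀ k t, MemLp (fun ω => c k * B k t ω) 2 P := fun k t =>
    (((hGP k).hasGaussianLaw_eval t).memLp_two).const_mul _
  refine ⟨IsGaussianProcess.isPreBrownianReal_of_covariance ⟨fun I => ?_⟩ (fun t => ?_)
    fun s t hst => ?_, ?_⟩
  · have hG : ∀ k, HasGaussianLaw (fun ω => c k • I.restrict (B k · ω)) P := fun k =>
      ((hGP k).hasGaussianLaw I).fun_smul (c k)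
    have hI : iIndepFun (fun k ω => c k • I.restrict (B k · ω)) P :=
      hind.comp (fun k x => c k • I.restrict x) fun k => by fun_prop
    have hfun : (fun ω => I.restrict fun t => ∑ k, c k * B k t ω)
        = fun ω => ∑ k, c k • I.restrict (B k · ω) := by
      ext ω t
      simp
    rw [hfun]
    exact hI.hasGaussianLaw_fun_sum hG
  · rw [integral_finsetSum _ fun k _ => (hL k t).integrable (by norm_num)]
    simp [integral_const_mul, (hB _).integral_eval]
  · rw [covariance_fun_sum_fun_sum (fun k => hL k s) fun k => hL k t]
    have hcov : ∀ k j, cov[fun ω => c k * B k s ω, fun ω => c j * B j t ω; P]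
        = if k = j then c k ^ 2 * s else 0 := by
      intro k j
      rw [covariance_const_mul_left, covariance_const_mul_right]
      split_ifs with h
      · subst h
        rw [(hB k).covariance_fun_eval, min_eq_left hst]
        ring
      · have hkj : IndepFun (B k s) (B j t) P :=
          (hind.indepFun h).comp (measurable_pi_apply s) (measurable_pi_apply t)
        have := hkj.covariance_eq_zero
          ((hGP k).hasGaussianLaw_eval s).memLp_two
          ((hGP j).hasGaussianLaw_eval t).memLp_two
        change c k * (c j * cov[B k s, B j t; P]) = 0
        rw [this, mul_zero, mul_zero]
    simp_rw [hcov]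
    simp [← Finset.sum_mul, hc]
  · filter_upwards [ae_all_iff.2 fun k => (hB k).cont] with ω hω
    exact continuous_finsetSum _ fun k _ => continuous_const.mul (hω k)

end LinearCombination

end ProbabilityTheory

/-! ### Tightness and extended continuous mapping. -/

section ContinuousMapping

variable {S : Type*} [SeminormedAddCommGroup S]
  {Ω : ℕ → Type*} [∀ n, MeasurableSpace (Ω n)] {P : ∀ n, Measure (Ω n)} {X : ∀ n, Ω n → S}
  [∀ n, IsProbabilityMeasure (P n)]
  {Ω' : Type*} [MeasurableSpace Ω'] {P' : Measure Ω'} [IsProbabilityMeasure P'] {G : Ω' → S}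

/-- The closed sets `k ≤ ‖x‖` decrease to the empty set, so the limit gives them vanishing mass. -/
lemma ConvergesWeakly.tendsto_measureReal_zero (h : ConvergesWeakly P X P' G)
    {E : ∀ n, Set (Ω n)} (hE : ∀ M : ℝ, ∀ᶠ n in atTop, ∀ ω ∈ E n, M ≤ ‖X n ω‖) :
    Tendsto (fun n => (P n).real (E n)) atTop (𝓝 0) := by
  refine tendsto_order.2 ⟨fun a ha => .of_forall fun n => ha.trans_le measureReal_nonneg,
    fun b hb => ?_⟩
  have hempty : ⋂ k : ℕ, {x : S | (k : ℝ) ≤ ‖x‖} = ∅ := by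
    refine eq_empty_of_forall_notMem fun x hx => ?_
    obtain ⟨k, hk⟩ := exists_nat_gt ‖x‖
    exact hk.not_ge (mem_iInter.1 hx k)
  have := h.eventually_measureReal_le (E := E) (C := fun k : ℕ => {x : S | (k : ℝ) ≤ ‖x‖})
    (b := b / 2) (fun k => isClosed_le continuous_const continuous_norm)
    (fun i j hij x (hx : (j : ℝ) ≤ ‖x‖) => (Nat.cast_le.2 hij).trans hx)
    (fun k => (hE k).mono fun n hn ω hω => hn ω hω) (by rw [hempty]; simpa using hb)
  filter_upwards [this] with n hn using by linarith

/-- An extended continuous mapping theorem: if `F n → F` uniformly on bounded sets, then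
asymptotically `F n (X n) ≤ 0` is at most as probable as `F G ≤ 0`. -/
lemma ConvergesWeakly.eventually_measureReal_le_of_nonpos (h : ConvergesWeakly P X P' G)
    {E : ∀ n, Set (Ω n)} {F : ℕ → S → ℝ} {F₀ : S → ℝ} (hF₀ : Continuous F₀)
    (hF : ∀ M δ : ℝ, 0 < δ → ∀ᶠ n in atTop, ∀ x, ‖x‖ ≤ M → |F n x - F₀ x| ≤ δ)
    (hE : ∀ᶠ n in atTop, ∀ ω ∈ E n, F n (X n ω) ≤ 0)
    {b : ℝ} (hb : P'.real {ω | F₀ (G ω) ≤ 0} < b) :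
    ∀ᶠ n in atTop, (P n).real (E n) ≤ b := by
  refine h.eventually_measureReal_le (E := E)
    -- Uniform convergence is available only on bounded sets, so the outside of a ball is added; it
    -- disappears in the intersection over `k`.
    (C := fun k : ℕ => {x : S | (k : ℝ) ≤ ‖x‖} ∪ {x | F₀ x ≤ 1 / ((k : ℝ) + 1)})
    (fun k => (isClosed_le continuous_const continuous_norm).union
      (isClosed_le hF₀ continuous_const)) ?_ ?_ ?_
  · refine fun i j hij => union_subset_union (fun x (hx : (j : ℝ) ≤ ‖x‖) => ?_)
      fun x (hx : F₀ x ≤ 1 / ((j : ℝ) + 1)) => ?_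
    · exact (Nat.cast_le.2 hij).trans hx
    · exact hx.trans (one_div_le_one_div_of_le (by positivity) (by gcongr))
  · intro k
    filter_upwards [hF k (1 / ((k : ℝ) + 1)) Nat.one_div_pos_of_nat, hE] with n hn hEn ω hω
    rcases le_total (k : ℝ) ‖X n ω‖ with hk | hk
    · exact Or.inl hk
    · refine Or.inr (?_ : F₀ (X n ω) ≤ _)
      linarith [hEn ω hω, (abs_le.1 (hn _ hk)).1]
  · refine (measureReal_mono fun ω hω => ?_).trans_lt hb
    obtain ⟨K, hK⟩ := exists_nat_gt ‖G ω‖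
    refine ge_of_tendsto (tendsto_one_div_add_atTop_nhds_zero_nat (𝕜 := ℝ)) ?_
    filter_upwards [eventually_ge_atTop K] with k hk
    rcases mem_iInter.1 hω k with h1 | h1
    · exact absurd (h1 : (k : ℝ) ≤ ‖G ω‖) (not_le.2 (hK.trans_le (Nat.cast_le.2 hk)))
    · exact h1

end ContinuousMapping

/-! ### Expansion of the squared root mean square around `β`. -/

section Expansion

variable {ε : ℝ} {T : ℕ}

/-- The path `t ↦ c⁻¹ (rms (β + c x(t))² - rms β²)`, extended to `c = 0`. -/
noncomputable def rmsIncrement (β : Fin T → ℝ) (c : ℝ) (x : EllInfty ε T) (t : Icc ε 1) : ℝ :=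
  ∑ l, (2 / (T : ℝ) * β l * x l t + c / T * x l t ^ 2)

/-- The operator norm bound of the linear part of `rmsIncrement`. -/
noncomputable def rmsSlope (β : Fin T → ℝ) : ℝ := ∑ l, |2 / (T : ℝ) * β l|

lemma rmsSlope_nonneg (β : Fin T → ℝ) : 0 ≤ rmsSlope β := Finset.sum_nonneg fun _ _ => abs_nonneg _

lemma rms_sq (b : Fin T → ℝ) : rms b ^ 2 = 1 / (T : ℝ) * ∑ l, b l ^ 2 :=
  Real.sq_sqrt (by positivity)

lemma rms_sq_sub_rms_sq {β b : Fin T → ℝ} {c : ℝ} {x : EllInfty ε T} {t : Icc ε 1}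
    (hb : ∀ l, b l = β l + c * x l t) :
    rms b ^ 2 - rms β ^ 2 = c * rmsIncrement β c x t := by
  simp only [rms_sq, rmsIncrement, hb, Finset.mul_sum, ← Finset.sum_sub_distrib]
  exact Finset.sum_congr rfl fun l _ => by ring

lemma EllInfty.abs_apply_le (x : EllInfty ε T) (l : Fin T) (t : Icc ε 1) : |x l t| ≤ ‖x‖ :=
  (lp.norm_apply_le_norm ENNReal.top_ne_zero (x l) t).trans (norm_le_pi_norm x l)

lemma abs_rmsIncrement_zero_sub_le (β : Fin T → ℝ) (x y : EllInfty ε T) (t : Icc ε 1) :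
    |rmsIncrement β 0 x t - rmsIncrement β 0 y t| ≤ rmsSlope β * ‖x - y‖ := by
  simp only [rmsIncrement, rmsSlope, ← Finset.sum_sub_distrib, Finset.sum_mul]
  refine (Finset.abs_sum_le_sum_abs _ _).trans (Finset.sum_le_sum fun l _ => ?_)
  have h := EllInfty.abs_apply_le (x - y) l t
  rw [show 2 / (T : ℝ) * β l * x l t + 0 / T * x l t ^ 2
      - (2 / (T : ℝ) * β l * y l t + 0 / T * y l t ^ 2)
      = 2 / (T : ℝ) * β l * (x - y) l t by
    rw [show (x - y) l t = x l t - y l t from rfl]; ring, abs_mul]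
  exact mul_le_mul_of_nonneg_left h (abs_nonneg _)

lemma abs_rmsIncrement_zero_le (β : Fin T → ℝ) (x : EllInfty ε T) (t : Icc ε 1) :
    |rmsIncrement β 0 x t| ≤ rmsSlope β * ‖x‖ := by
  have h := abs_rmsIncrement_zero_sub_le β x 0 t
  have h0 : rmsIncrement β 0 (0 : EllInfty ε T) t = 0 := by
    simp [rmsIncrement]
  rwa [h0, sub_zero, sub_zero] at h

lemma abs_rmsIncrement_sub_zero_le (β : Fin T → ℝ) {c : ℝ} (hc : 0 ≤ c) (x : EllInfty ε T)
    (t : Icc ε 1) : |rmsIncrement β c x t - rmsIncrement β 0 x t| ≤ c * ‖x‖ ^ 2 := by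
  simp only [rmsIncrement, ← Finset.sum_sub_distrib]
  refine (Finset.abs_sum_le_sum_abs _ _).trans ?_
  have hl : ∀ l ∈ Finset.univ, |2 / (T : ℝ) * β l * x l t + c / T * x l t ^ 2
      - (2 / (T : ℝ) * β l * x l t + 0 / T * x l t ^ 2)| ≤ c / T * ‖x‖ ^ 2 := fun l _ => by
    rw [zero_div, zero_mul, add_zero, add_sub_cancel_left, abs_of_nonneg (by positivity)]
    refine mul_le_mul_of_nonneg_left ?_ (by positivity)
    exact sq_le_sq' (abs_le.1 (EllInfty.abs_apply_le x l t)).1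
      (abs_le.1 (EllInfty.abs_apply_le x l t)).2
  refine (Finset.sum_le_sum hl).trans ?_
  rw [Finset.sum_const, Finset.card_univ, Fintype.card_fin, nsmul_eq_mul]
  rcases Nat.eq_zero_or_pos T with rfl | hT
  · simp; positivity
  · have : (T : ℝ) ≠ 0 := by positivity
    exact le_of_eq (by field_simp)

lemma abs_rmsIncrement_le (β : Fin T → ℝ) {c M : ℝ} (hc : 0 ≤ c) (hc1 : c ≤ 1) {x : EllInfty ε T}
    (hx : ‖x‖ ≤ M) (t : Icc ε 1) : |rmsIncrement β c x t| ≤ rmsSlope β * M + M ^ 2 := by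
  have h1 := abs_rmsIncrement_sub_zero_le β hc x t
  have h2 := abs_rmsIncrement_zero_le β x t
  have h3 := abs_sub_abs_le_abs_sub (rmsIncrement β c x t) (rmsIncrement β 0 x t)
  have h4 : rmsSlope β * ‖x‖ ≤ rmsSlope β * M := mul_le_mul_of_nonneg_left hx (rmsSlope_nonneg β)
  have h5 : c * ‖x‖ ^ 2 ≤ 1 * M ^ 2 := by gcongr
  linarith

variable (ν : Measure (Icc ε 1)) (a : Icc ε 1) (q : ℝ) (β : Fin T → ℝ)

lemma continuous_pivotGap_rmsIncrement [IsFiniteMeasure ν] :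
    Continuous fun x : EllInfty ε T => pivotGap ν a q (rmsIncrement β 0 x) := by
  refine continuous_iff_continuousAt.2 fun x => tendsto_iff_dist_tendsto_zero.2 ?_
  have hK := rmsSlope_nonneg β
  -- The radius varies with `y` so that one bound covers both paths on the whole space.
  let M : EllInfty ε T → ℝ := fun y => rmsSlope β * (‖y‖ + ‖x‖)
  let δ : EllInfty ε T → ℝ := fun y => rmsSlope β * ‖y - x‖
  have hbound : ∀ y, dist (pivotGap ν a q (rmsIncrement β 0 y)) (pivotGap ν a q (rmsIncrement β 0 x))
      ≤ δ y + |q| * √(8 * M y * δ y * ν.real univ) := fun y => by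
    refine abs_pivotGap_sub_le a q (by positivity) (by positivity) (fun t => ?_) (fun t => ?_)
      fun t => abs_rmsIncrement_zero_sub_le β y x t
    · refine (abs_rmsIncrement_zero_le β y t).trans ?_
      exact mul_le_mul_of_nonneg_left (by linarith [norm_nonneg x]) hK
    · refine (abs_rmsIncrement_zero_le β x t).trans ?_
      exact mul_le_mul_of_nonneg_left (by linarith [norm_nonneg y]) hK
  refine squeeze_zero (fun _ => dist_nonneg) hbound ?_
  have hcont : Continuous fun y => δ y + |q| * √(8 * M y * δ y * ν.real univ) := by fun_prop
  simpa [δ] using hcont.tendsto x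

lemma eventually_abs_pivotGap_rmsIncrement_sub_le [IsFiniteMeasure ν] {c : ℕ → ℝ} (hc : ∀ n, 0 ≤ c n)
    (hlim : Tendsto c atTop (𝓝 0)) (M δ : ℝ) (hδ : 0 < δ) :
    ∀ᶠ n in atTop, ∀ x : EllInfty ε T, ‖x‖ ≤ M →
      |pivotGap ν a q (rmsIncrement β (c n) x) - pivotGap ν a q (rmsIncrement β 0 x)| ≤ δ := by
  have hK := rmsSlope_nonneg β
  have hcont : Continuous fun r : ℝ => r * M ^ 2
      + |q| * √(8 * (rmsSlope β * M + M ^ 2) * (r * M ^ 2) * ν.real univ) := by fun_prop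
  have hlim' := (hcont.tendsto 0).comp hlim
  simp only [zero_mul, mul_zero, Real.sqrt_zero, add_zero] at hlim'
  filter_upwards [hlim'.eventually_le_const hδ, hlim.eventually_le_const one_pos] with n hn hn1 x hx
  have hM : 0 ≤ M := (norm_nonneg x).trans hx
  refine (abs_pivotGap_sub_le a q (by positivity) (mul_nonneg (hc n) (sq_nonneg M))
    (abs_rmsIncrement_le β (hc n) hn1 hx) (abs_rmsIncrement_le β le_rfl zero_le_one hx)
    fun t => (abs_rmsIncrement_sub_zero_le β (hc n) x t).trans ?_).trans hn
  have := hc n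
  gcongr

/-- Comparison with the zero path, where the functional vanishes. -/
lemma exists_abs_pivotGap_rmsIncrement_le [IsFiniteMeasure ν] (M : ℝ) :
    ∃ C, ∀ c : ℝ, 0 ≤ c → c ≤ 1 → ∀ x : EllInfty ε T, ‖x‖ ≤ M →
      |pivotGap ν a q (rmsIncrement β c x)| ≤ C := by
  let A := rmsSlope β * M + M ^ 2
  refine ⟨A + |q| * √(8 * A * A * ν.real univ), fun c hc hc1 x hx => ?_⟩
  have hM : 0 ≤ M := (norm_nonneg x).trans hx
  have hK := rmsSlope_nonneg β
  have hA : 0 ≤ rmsSlope β * M + M ^ 2 := by positivity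
  have h := abs_pivotGap_sub_le (ν := ν) a q (g := fun _ => 0) hA hA
    (abs_rmsIncrement_le β hc hc1 hx) (fun _ => by simpa using hA)
    fun t => by simpa using abs_rmsIncrement_le β hc hc1 hx t
  rwa [pivotGap_zero, sub_zero] at h

/-- The test rejects iff its studentized statistic, in terms of the rescaled estimation error,
is negative. -/
lemma mem_rejectionEvent_iff (hε : ε ≤ 1) {Ω : Type*} {βhat : Icc ε 1 → Ω → Fin T → ℝ} {ω : Ω}
    (hmeas : Measurable fun t => βhat t ω) {c : ℝ} (hc : 0 < c) {x : EllInfty ε T}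
    (hx : ∀ l t, βhat t ω l = β l + c * x l t) (ζ : ℝ) :
    ω ∈ rejectionEvent hε ν ζ q βhat ↔
      rms β ^ 2 - ζ ^ 2 + c * pivotGap ν (rightEnd hε) q (rmsIncrement β c x) < 0 := by
  have hinc : ∀ t, rms (βhat t ω) ^ 2 = rms β ^ 2 + c * rmsIncrement β c x t := fun t => by
    rw [← rms_sq_sub_rms_sq fun l => hx l t]; ring
  have hm : Measurable fun t => rms (βhat t ω) ^ 2 := by
    simp_rw [rms_sq]
    exact (Finset.measurable_fun_sum _ fun l _ =>
      ((measurable_pi_apply l).comp hmeas).pow_const 2).const_mul _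
  have hV : selfNormalizer hε ν (fun t => βhat t ω) = √(lowerSqIntegral ν fun t =>
      c * rmsIncrement β c x t - c * rmsIncrement β c x (rightEnd hε)) := by
    have : (fun t => c * rmsIncrement β c x t - c * rmsIncrement β c x (rightEnd hε))
        = fun t => rms (βhat t ω) ^ 2 - rms (βhat (rightEnd hε) ω) ^ 2 := by
      ext t; rw [hinc, hinc]; ring
    -- Here joint measurability of the estimator enters: its path is measurable, so both integrals
    -- agree.
    rw [this, lowerSqIntegral_eq_integral (hm.sub_const _), selfNormalizer]
  rw [← pivotGap_const_mul _ _ hc.le, pivotGap, ← hV, rejectionEvent, mem_ofPred_eq, hinc]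
  constructor <;> intro h <;> linarith

end Expansion

lemma Matrix.vecMul_ne_zero_of_rank_eq {T : ℕ} {D : Matrix (Fin T) (Fin T) ℝ} (hD : D.rank = T)
    {β : Fin T → ℝ} (hβ : β ≠ 0) : Matrix.vecMul β D ≠ 0 := by
  have hli : LinearIndependent ℝ D.row := by
    rw [linearIndependent_iff_card_eq_finrank_span, Fintype.card_fin]
    exact (D.rank_eq_finrank_span_row.symm.trans hD).symm
  intro h
  exact hβ (Matrix.vecMul_injective_iff.2 hli (h.trans (Matrix.zero_vecMul D).symm))

/-! ### Identification of the limit with the pivot. -/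

section LimitLaw

variable {ε : ℝ} {T : ℕ} (ν : Measure (Icc ε 1))

lemma pivotGap_scaled_brownian (hε0 : 0 < ε) (hε1 : ε ≤ 1) (q : ℝ) {Ω : Type*} {B : ℝ≥0 → Ω → ℝ}
    {ω : Ω}     (h : Continuous (B · ω)) :
    pivotGap ν (rightEnd hε1) q (fun t => B (Real.toNNReal t) ω / (t : ℝ))
      = B 1 ω - q * √(∫ t, scaledBridge ε B t ω ^ 2 ∂ν) := by
  have h1 : B (Real.toNNReal (rightEnd hε1)) ω / (rightEnd hε1 : ℝ) = B 1 ω := by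
    simp [rightEnd]
  rw [pivotGap, h1, ← lowerSqIntegral_eq_integral (continuous_scaledBridge hε0 h).measurable]
  rfl

variable {Ω' : Type*} [MeasurableSpace Ω'] {P' : Measure Ω'}

/-- In the limit, the statistic of the test is a positive multiple of that of the pivot, for a
Brownian motion `W`. -/
lemma exists_brownian_pivotGap_eq (hε0 : 0 < ε) (hε1 : ε ≤ 1) {β : Fin T → ℝ} (hT : 1 ≤ T)
    {D : Matrix (Fin T) (Fin T) ℝ} (hD : D.rank = T) (hβ : β ≠ 0) (q : ℝ)
    {B : Fin T → ℝ≥0 → Ω' → ℝ} (hB : ∀ k, IsBrownianReal (B k) P')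
    (hind : iIndepFun (fun (k : Fin T) (ω : Ω') (t : ℝ≥0) => B k t ω) P')
    {G : Ω' → EllInfty ε T} (hG : ∀ᵐ ω ∂P', ∀ l (t : Icc ε 1),
      G ω l t = (t : ℝ)⁻¹ * (D.mulVec fun k => B k (Real.toNNReal t) ω) l) :
    ∃ (W : ℝ≥0 → Ω' → ℝ) (r : ℝ), IsBrownianReal W P' ∧ 0 < r ∧ ∀ᵐ ω ∂P',
      pivotGap ν (rightEnd hε1) q (rmsIncrement β 0 (G ω))
        = r * (W 1 ω - q * √(∫ t, scaledBridge ε W t ω ^ 2 ∂ν)) := by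
  let v := Matrix.vecMul β D
  have hv : v ≠ 0 := Matrix.vecMul_ne_zero_of_rank_eq hD hβ
  have hsum : 0 < ∑ k, v k ^ 2 := by
    obtain ⟨k, hk⟩ := Function.ne_iff.1 hv
    exact Finset.sum_pos' (fun _ _ => sq_nonneg _) ⟨k, Finset.mem_univ k, sq_pos_iff.2 hk⟩
  let σ := √(∑ k, v k ^ 2)
  have hσ : 0 < σ := Real.sqrt_pos.2 hsum
  let W : ℝ≥0 → Ω' → ℝ := fun t ω => ∑ k, v k / σ * B k t ω
  have hW : IsBrownianReal W P' := by
    refine IsBrownianReal.linear_combination hB hind ?_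
    simp_rw [div_pow, ← Finset.sum_div]
    rw [Real.sq_sqrt hsum.le, div_self hsum.ne']
  have hT' : (0 : ℝ) < T := by exact_mod_cast hT
  -- `2 / T` comes from the derivative of the mean square, `σ` from normalizing `Dᵀβ`.
  refine ⟨W, 2 * σ / T, hW, by positivity, ?_⟩
  filter_upwards [hG, hW.cont] with ω hω hc
  rw [← pivotGap_scaled_brownian ν hε0 hε1 q hc, ← pivotGap_const_mul _ _ (by positivity)]
  congr 1
  ext t
  have hdot : ∑ l, β l * (D.mulVec fun k => B k (Real.toNNReal t) ω) l
      = ∑ k, v k * B k (Real.toNNReal t) ω :=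
    Matrix.dotProduct_mulVec β D fun k => B k (Real.toNNReal t) ω
  have hsc : W (Real.toNNReal t) ω = σ⁻¹ * ∑ k, v k * B k (Real.toNNReal t) ω := by
    simp only [W, Finset.mul_sum]
    exact Finset.sum_congr rfl fun k _ => by ring
  have hinc : rmsIncrement β 0 (G ω) t
      = 2 / T * (t : ℝ)⁻¹ * ∑ l, β l * (D.mulVec fun k => B k (Real.toNNReal t) ω) l := by
    rw [rmsIncrement, Finset.mul_sum]
    refine Finset.sum_congr rfl fun l _ => ?_
    rw [hω]
    ring
  rw [hinc, hdot, hsc]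
  field_simp

/-- The quantile is defined through another Brownian motion; both events depend only on the joint
law of endpoint and integral, which is common to the two. -/
lemma measureReal_brownian_le_quantile [IsFiniteMeasure ν] (hε0 : 0 < ε) (hε1 : ε ≤ 1) (hν : ν {rightEnd hε1}ᶜ ≠ 0)
    {W : ℝ≥0 → Ω' → ℝ} (hW : IsBrownianReal W P')
    {Ω₀ : Type*} [MeasurableSpace Ω₀] {P₀ : Measure Ω₀} {B₀ : ℝ≥0 → Ω₀ → ℝ}
    (hB₀ : IsBrownianReal B₀ P₀) {α : ℝ} (hα0 : 0 < α) (hα1 : α < 1) :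
    P'.real {ω | W 1 ω - quantile P₀ (limitW ν B₀) α * √(∫ t, scaledBridge ε W t ω ^ 2 ∂ν) ≤ 0} = α ∧
    P'.real {ω | 0 ≤ W 1 ω - quantile P₀ (limitW ν B₀) α * √(∫ t, scaledBridge ε W t ω ^ 2 ∂ν)}
      = 1 - α := by
  set q := quantile P₀ (limitW ν B₀) α with hq
  have hmap := hW.map_one_integral_scaledBridge_eq ν hε0 hB₀
  have hYW := (hW.aemeasurable 1).prodMk (hW.aemeasurable_integral_scaledBridge ν hε0)
  have hY₀ := (hB₀.aemeasurable 1).prodMk (hB₀.aemeasurable_integral_scaledBridge ν hε0)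
  have htransfer : ∀ s : Set (ℝ × ℝ), MeasurableSet s →
      P'.real ((fun ω => (W 1 ω, ∫ t, scaledBridge ε W t ω ^ 2 ∂ν)) ⁻¹' s)
        = P₀.real ((fun ω => (B₀ 1 ω, ∫ t, scaledBridge ε B₀ t ω ^ 2 ∂ν)) ⁻¹' s) := fun s hs => by
    rw [← map_measureReal_apply_of_aemeasurable hYW hs, hmap,
      map_measureReal_apply_of_aemeasurable hY₀ hs]
  simp only [sub_nonpos, sub_nonneg]
  constructor
  · rw [← hB₀.measureReal_le_quantile ν hε0 hε1 hν hα0 hα1, ← hq]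
    exact htransfer {p | p.1 ≤ q * √p.2} (measurableSet_le (by fun_prop) (by fun_prop))
  · rw [← hB₀.measureReal_ge_quantile ν hε0 hε1 hν hα0 hα1, ← hq]
    exact htransfer {p | q * √p.2 ≤ p.1} (measurableSet_le (by fun_prop) (by fun_prop))

end LimitLaw

/-! ### Asymptotics of the test. -/

section Test

variable {T : ℕ} {ε : ℝ} (hε1 : ε ≤ 1) (ν : Measure (Icc ε 1))
  {Ω : ℕ → Type*} {βhat : ∀ n, Icc ε 1 → Ω n → Fin T → ℝ}
  {β : Fin T → ℝ} {X : ∀ n, Ω n → EllInfty ε T}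

lemma tendsto_inv_sqrt_natCast : Tendsto (fun n : ℕ => (√(n : ℝ))⁻¹) atTop (𝓝 0) :=
  tendsto_inv_atTop_zero.comp (Real.tendsto_sqrt_atTop.comp tendsto_natCast_atTop_atTop)

/-- On the ball of radius `M` the functional is bounded by some `C`, and `C / √n` eventually drops
below `δ`. -/
lemma eventually_le_norm_of_le_abs [IsFiniteMeasure ν] (a : Icc ε 1) (q : ℝ) {E : ∀ n, Set (Ω n)}
    {δ : ℝ} (hδ : 0 < δ)
    (hE : ∀ᶠ n : ℕ in atTop, ∀ ω ∈ E n,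
      δ ≤ (√(n : ℝ))⁻¹ * |pivotGap ν a q (rmsIncrement β (√(n : ℝ))⁻¹ (X n ω))|) (M : ℝ) :
    ∀ᶠ n in atTop, ∀ ω ∈ E n, M ≤ ‖X n ω‖ := by
  obtain ⟨C, hC⟩ := exists_abs_pivotGap_rmsIncrement_le (T := T) ν a q β M
  have hlim : Tendsto (fun n : ℕ => (√(n : ℝ))⁻¹ * C) atTop (𝓝 0) := by
    simpa using tendsto_inv_sqrt_natCast.mul_const C
  filter_upwards [hE, hlim.eventually_lt_const hδ,
    tendsto_inv_sqrt_natCast.eventually_le_const one_pos] with n hn hlt h1 ω hω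
  by_contra! hlt'
  have h0 : 0 ≤ (√(n : ℝ))⁻¹ := by positivity
  have := mul_le_mul_of_nonneg_left (hC _ h0 h1 _ hlt'.le) h0
  linarith [hn ω hω]

lemma mem_rejectionEvent_iff_of_scaled [∀ n, MeasurableSpace (Ω n)]
    (hβhat : ∀ n, Measurable (fun p : Icc ε 1 × Ω n => βhat n p.1 p.2))
    (hX : ∀ n ω l (t : Icc ε 1), X n ω l t = √(n : ℝ) * (βhat n t ω l - β l)) (ζ q : ℝ)
    {n : ℕ} (hn : 0 < n) (ω : Ω n) :
    ω ∈ rejectionEvent hε1 ν ζ q (βhat n) ↔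
      rms β ^ 2 - ζ ^ 2
        + (√(n : ℝ))⁻¹ * pivotGap ν (rightEnd hε1) q (rmsIncrement β (√(n : ℝ))⁻¹ (X n ω)) < 0 := by
  have hs : 0 < √(n : ℝ) := Real.sqrt_pos.2 (Nat.cast_pos.2 hn)
  have hm : Measurable fun t => βhat n t ω :=
    (hβhat n).comp (measurable_id.prodMk (measurable_const (a := ω)))
  have hx : ∀ l t, βhat n t ω l = β l + (√(n : ℝ))⁻¹ * X n ω l t := fun l t => by
    rw [hX, inv_mul_cancel_left₀ hs.ne']
    ring
  exact mem_rejectionEvent_iff ν q β hε1 hm (inv_pos.2 hs) hx ζ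

end Test

/-- Subadditivity gives `1 ≤ P(E) + P(Eᶜ)` without measurability of `E`, so upper bounds on both
suffice. -/
lemma tendsto_measureReal_of_compl {Ω : ℕ → Type*} [∀ n, MeasurableSpace (Ω n)]
    {P : ∀ n, Measure (Ω n)} [∀ n, IsProbabilityMeasure (P n)] {E : ∀ n, Set (Ω n)} {a : ℝ}
    (hlo : ∀ b, 1 - a < b → ∀ᶠ n in atTop, (P n).real (E n)ᶜ ≤ b)
    (hup : ∀ b, a < b → ∀ᶠ n in atTop, (P n).real (E n) ≤ b) :
    Tendsto (fun n => (P n).real (E n)) atTop (𝓝 a) := by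
  refine tendsto_order.2 ⟨fun b hb => ?_, fun b hb => ?_⟩
  · filter_upwards [hlo (1 - (a + b) / 2) (by linarith)] with n hn
    have h := measureReal_union_le (μ := P n) (E n) (E n)ᶜ
    rw [union_compl_self, probReal_univ] at h
    linarith
  · filter_upwards [hup ((a + b) / 2) (by linarith)] with n hn
    linarith

theorem theorem3
    {T : ℕ} (hT : 1 ≤ T)
    {ε : ℝ} (hε0 : 0 < ε) (hε1 : ε ≤ 1)
    -- the measure in the self-normalizer; it is not concentrated at the point 1
    (ν : Measure (Icc ε 1)) [IsFiniteMeasure ν] (hν : ν {rightEnd hε1}ᶜ ≠ 0)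
    -- the samples of size n and the sequential estimators
    {Ω : ℕ → Type*} [∀ n, MeasurableSpace (Ω n)]
    (P : ∀ n, Measure (Ω n)) [∀ n, IsProbabilityMeasure (P n)]
    (βhat : ∀ n, Icc ε 1 → Ω n → Fin T → ℝ)
    (hβhat : ∀ n, Measurable (fun p : Icc ε 1 × Ω n => βhat n p.1 p.2))
    (β : Fin T → ℝ)
    -- sequential asymptotic normality
    (D : Matrix (Fin T) (Fin T) ℝ)
    {Ω' : Type*} [MeasurableSpace Ω'] (P' : Measure Ω') [IsProbabilityMeasure P']
    (B : Fin T → ℝ≥0 → Ω' → ℝ)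
    (hseq : SequentialNormality P βhat β D P' B)
    -- the Brownian motion that defines the pivotal variable W
    {Ω₀ : Type*} [MeasurableSpace Ω₀] (P₀ : Measure Ω₀) [IsProbabilityMeasure P₀]
    (B₀ : ℝ≥0 → Ω₀ → ℝ) (hB₀ : IsBrownianReal B₀ P₀)
    -- the equivalence threshold and the level
    {ζ : ℝ} (hζ : 0 < ζ) {α : ℝ} (hα0 : 0 < α) (hα1 : α < 1) :
    (rms β ^ 2 > ζ ^ 2 →
      Tendsto (fun n => (P n).real
        (rejectionEvent hε1 ν ζ (quantile P₀ (limitW ν B₀) α) (βhat n))) atTop (𝓝 0)) ∧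
    (rms β ^ 2 = ζ ^ 2 →
      Tendsto (fun n => (P n).real
        (rejectionEvent hε1 ν ζ (quantile P₀ (limitW ν B₀) α) (βhat n))) atTop (𝓝 α)) ∧
    (rms β ^ 2 < ζ ^ 2 →
      Tendsto (fun n => (P n).real
        (rejectionEvent hε1 ν ζ (quantile P₀ (limitW ν B₀) α) (βhat n))) atTop (𝓝 1)) ∧
    -- asymptotic level α under the null hypothesis
    (ζ ^ 2 ≤ rms β ^ 2 →
      limsup (fun n => (P n).real
        (rejectionEvent hε1 ν ζ (quantile P₀ (limitW ν B₀) α) (βhat n))) atTop ≤ α) := by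
  obtain ⟨X, G, hX, hG, hconv⟩ := hseq.weak_convergence
  set q := quantile P₀ (limitW ν B₀) α with hq
  have hmem := fun {n} (hn : 0 < n) (ω : Ω n) =>
    mem_rejectionEvent_iff_of_scaled hε1 ν hβhat hX ζ q hn ω
  have hc : ∀ n : ℕ, 0 ≤ (√(n : ℝ))⁻¹ := fun n => by positivity
  have habs : ∀ (n : ℕ) (y : ℝ), |(√(n : ℝ))⁻¹ * y| = (√(n : ℝ))⁻¹ * |y| := fun n y => by
    rw [abs_mul, abs_of_nonneg (hc n)]
  have hgt : rms β ^ 2 > ζ ^ 2 →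
      Tendsto (fun n => (P n).real (rejectionEvent hε1 ν ζ q (βhat n))) atTop (𝓝 0) := by
    intro h
    refine hconv.tendsto_measureReal_zero (eventually_le_norm_of_le_abs (β := β) ν (rightEnd hε1) q
      (sub_pos.2 h) ?_)
    filter_upwards [eventually_gt_atTop 0] with n hn ω hω
    rw [← habs]
    linarith [(hmem hn ω).1 hω, neg_abs_le ((√(n : ℝ))⁻¹ *
      pivotGap ν (rightEnd hε1) q (rmsIncrement β (√(n : ℝ))⁻¹ (X n ω)))]
  have heq : rms β ^ 2 = ζ ^ 2 →
      Tendsto (fun n => (P n).real (rejectionEvent hε1 ν ζ q (βhat n))) atTop (𝓝 α) := by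
    intro h
    -- This is where `ζ > 0` is needed: at `β = 0` the linear part would vanish.
    have hβ : β ≠ 0 := by
      rintro rfl
      have h0 : rms (0 : Fin T → ℝ) ^ 2 = 0 := by simp [rms_sq]
      exact (pow_pos hζ 2).ne (h0.symm.trans h)
    obtain ⟨W, r, hW, hr, hlaw⟩ := exists_brownian_pivotGap_eq ν hε0 hε1 hT hseq.full_rank hβ q
      hseq.brownian hseq.indep hG
    obtain ⟨hle, hge⟩ := measureReal_brownian_le_quantile ν hε0 hε1 hν hW hB₀ hα0 hα1
    have hcont := continuous_pivotGap_rmsIncrement ν (rightEnd hε1) q β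
    have hunif := eventually_abs_pivotGap_rmsIncrement_sub_le ν (rightEnd hε1) q β hc
      tendsto_inv_sqrt_natCast
    have hsign : ∀ {n : ℕ}, 0 < n → ∀ ω : Ω n, ω ∈ rejectionEvent hε1 ν ζ q (βhat n) ↔
        pivotGap ν (rightEnd hε1) q (rmsIncrement β (√(n : ℝ))⁻¹ (X n ω)) < 0 := fun {n} hn ω => by
      have hpos : 0 < (√(n : ℝ))⁻¹ := inv_pos.2 (Real.sqrt_pos.2 (Nat.cast_pos.2 hn))
      rw [hmem hn, h, sub_self, zero_add, mul_neg_iff]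
      simp [hpos, hpos.not_gt]
    -- Both closed half-lines are used; their limit probabilities `1 - α` and `α` add up to 1 since
    -- the pivot has no atoms.
    refine tendsto_measureReal_of_compl (fun b hb => ?_) fun b hb => ?_
    · refine hconv.eventually_measureReal_le_of_nonpos hcont.neg
        (F := fun n x => -pivotGap ν (rightEnd hε1) q (rmsIncrement β (√(n : ℝ))⁻¹ x)) ?_ ?_ ?_
      · intro M δ hδ
        filter_upwards [hunif M δ hδ] with n hn x hx
        rw [Pi.neg_apply, neg_sub_neg, abs_sub_comm]
        exact hn x hx
      · filter_upwards [eventually_gt_atTop 0] with n hn ω hω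
        exact neg_nonpos.2 (not_lt.1 fun hlt => hω ((hsign hn ω).2 hlt))
      · refine (le_of_eq ?_).trans_lt (hge.trans_lt hb)
        refine measureReal_congr ?_
        filter_upwards [hlaw] with ω hω
        refine propext ?_
        change -pivotGap ν (rightEnd hε1) q (rmsIncrement β 0 (G ω)) ≤ 0 ↔ 0 ≤ _
        rw [hω, neg_nonpos, mul_nonneg_iff_of_pos_left hr]
    · refine hconv.eventually_measureReal_le_of_nonpos hcont hunif ?_ ?_
      · filter_upwards [eventually_gt_atTop 0] with n hn ω hω using ((hsign hn ω).1 hω).le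
      · refine (le_of_eq ?_).trans_lt (hle.trans_lt hb)
        refine measureReal_congr ?_
        filter_upwards [hlaw] with ω hω
        refine propext ?_
        change pivotGap ν (rightEnd hε1) q (rmsIncrement β 0 (G ω)) ≤ 0 ↔ _ ≤ 0
        rw [hω, mul_nonpos_iff_pos_imp_nonpos]
        exact ⟨fun h => h.1 hr, fun h => ⟨fun _ => h, fun _ => hr.le⟩⟩
  refine ⟨hgt, heq, fun h => ?_, fun h => ?_⟩
  · have hcompl : Tendsto (fun n => (P n).real (rejectionEvent hε1 ν ζ q (βhat n))ᶜ) atTop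
        (𝓝 0) := by
      refine hconv.tendsto_measureReal_zero (eventually_le_norm_of_le_abs (β := β) ν
        (rightEnd hε1) q (sub_pos.2 h) ?_)
      filter_upwards [eventually_gt_atTop 0] with n hn ω hω
      rw [← habs]
      have h1 := not_lt.1 fun hlt => hω ((hmem hn ω).2 hlt)
      linarith [le_abs_self ((√(n : ℝ))⁻¹ *
        pivotGap ν (rightEnd hε1) q (rmsIncrement β (√(n : ℝ))⁻¹ (X n ω)))]
    refine tendsto_measureReal_of_compl (fun b hb => ?_) fun b hb => ?_
    · exact hcompl.eventually_le_const (by linarith)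
    · exact .of_forall fun n => measureReal_le_one.trans hb.le
  · rcases h.eq_or_lt with h | h
    · exact (heq h.symm).limsup_eq.le
    · exact (hgt h).limsup_eq.le.trans hα0.le
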